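/- \textbf{Conventions.} A $\mathbf Q$-ideal in a commutative ring $R$ is an equivalence class of symbols $J^q$, with $J\subseteq R$ an ideal and $q\in\mathbf Q_{>0}$, where $J_1^{q_1}\sim J_2^{q_2}$ if for every positive integer $m$ with $mq_1,mq_2\in\mathbf Z$ the ideals $J_1^{mq_1}$ and $J_2^{mq_2}$ have the same integral closure. (For $J\neq 0$ one puts $J^0:=(1)^1$, and the zero $\mathbf Q$-ideal is $(0)^q$ for any $q$.) One writes $J_1^{q_1}\le J_2^{q_2}$ if for every such $m$ the ideal $J_1^{mq_1}$ is contained in the integral closure of $J_2^{mq_2}$; $(J^q)^{r}:=J^{qr}$ for $r\in\mathbf Q_{>0}$; and the pull-back of $J^q$ along a ring homomorphism $R\to S$ is $(JS)^q$. For a field $K$ of characteristic zero, a $\mathbf Q$-ideal $\mathfrak b$ in $\mathbf Q[z_1,\dots,z_n]$ and $u_1,\dots,u_n\in K[[t^{1/N}]]$, $\mathfrak b(u_1,\dots,u_n)$ is the pull-back of $\mathfrak b$ along $z_i\mapsto u_i$, and $\mathfrak bK[z_1,\dots,z_n]$ is its pull-back to $K[z_1,\dots,z_n]$. The order $\mathrm{ord}$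 is taken with respect to $t$, so that the $\mathbf Q$-ideal $(t)^q$ of $K[[t^{1/N}]]$ has order $q$, and $\mathrm{ord}(0)=\infty$. We use $\infty-\infty=\infty$ and $0\cdot\infty=0$. For an algebraically closed field $K$ of characteristic zero and $a=(a_1,\dots,a_d)\in K[[t]]^d$, let $\alpha_1,\dots,\alpha_d$ be the roots, with multiplicity, of $h=y^d+a_1y^{d-1}+\dots+a_d$; they are Puiseux series, lying in $K[[t^{1/N}]]$ for some $N\ge 1$. \textbf{Statement.} (1) Let $d,k$ be positive integers with $k\le d$ and let $c_1,c_2$ be nonnegative rational numbers. There are $\mathbf Q$-ideals $\mathfrak p_+,\mathfrak p_-$ in $\mathbf Q[z_1,\dots,z_d]$, such that for every algebraically closed field $K$ of characteristic zero: (i) if $d\ge 2$, then $\mathfrak p_+K[z_1,\dots,z_d]\le\left(\mathfrak p_-K[z_1,\dots,z_d]\right)^{d/(d-1)}$; (ii) for all $a\in K[[t]]^d$, with $\alpha_1,\dots,\alpha_d$ as above, $$\max_{1\le i\le d}\Big\{c_1\min_{j_1,\dots,j_{k-1}}\mathrm{ord}\prod_{\ell=1}^{k-1}(\alpha_{j_\ell}-\alpha_i)+c_2\min_{j_1,\dots,j_k}\mathrm{ord}\prod_{\ell=1}^{k}(\alpha_{j_\ell}-\alpha_i)\Big\}=\mathrm{ord}\,\mathfrak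 p_+(a)-\mathrm{ord}\,\mathfrak p_-(a),$$ where each minimum is over pairwise distinct elements of $\{1,\dots,d\}$. (2) More generally, let $d\ge1$ and let $\mathfrak b$ be any $\mathbf Q$-ideal in $\mathbf Q[z_1,\dots,z_{d+1}]$. There are $\mathbf Q$-ideals $\mathfrak b_+,\mathfrak b_-$ in $\mathbf Q[z_1,\dots,z_d]$ such that for every algebraically closed field $K$ of characteristic zero: if $d\ge2$, then $\mathfrak b_+K[z_1,\dots,z_d]\le(\mathfrak b_-K[z_1,\dots,z_d])^{d/(d-1)}$; and for all $a\in K[[t]]^d$, with $\alpha_1,\dots,\alpha_d$ as above, $$\max_{1\le i\le d}\mathrm{ord}\,\mathfrak b(a_1,\dots,a_d,\alpha_i)=\mathrm{ord}\,\mathfrak b_+(a)-\mathrm{ord}\,\mathfrak b_-(a).$$ -/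

import Mathlib

open Polynomial
open scoped ENNReal NNReal

/-! ### Integral closure of an ideal -/

/-- `x` is integral of weight `k` over `I`: it satisfies an equation
`x ^ n + c₁ x ^ (n - 1) + ⋯ + cₙ = 0` with `cᵢ ∈ I ^ (k * i)`. -/
def IsWeightIntegral {R : Type*} [CommRing R] (I : Ideal R) (k : ℕ) (x : R) : Prop :=
  ∃ (n : ℕ) (c : ℕ → R), (∀ i, c i ∈ I ^ (k * i)) ∧
    x ^ n + ∑ i ∈ Finset.Icc 1 n, c i * x ^ (n - i) = 0

theorem isIntegral_rees_iff {R : Type*} [CommRing R] (I : Ideal R) (k : ℕ) (x : R) :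
    IsIntegral (reesAlgebra I) (monomial k x) ↔ IsWeightIntegral I k x := by
  constructor
  · rintro ⟨P, hP, hx⟩
    refine ⟨P.natDegree, fun i => (P.coeff (P.natDegree - i) : R[X]).coeff (k * i),
      fun i => (P.coeff (P.natDegree - i)).2 _, ?_⟩
    have h := congrArg (fun f => Polynomial.coeff f (k * P.natDegree)) hx
    simp only [eval₂_eq_sum_range, finsetSum_coeff, coeff_zero, monomial_pow] at h
    have key : ∀ j ∈ Finset.range (P.natDegree + 1),
        ((algebraMap (reesAlgebra I) R[X]) (P.coeff j) * monomial (k * j) (x ^ j)).coeff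
          (k * P.natDegree) = (P.coeff j : R[X]).coeff (k * (P.natDegree - j)) * x ^ j := by
      intro j hj
      have hj' : j ≤ P.natDegree := Nat.lt_succ_iff.mp (Finset.mem_range.mp hj)
      have e : k * P.natDegree = k * (P.natDegree - j) + k * j := by
        rw [← mul_add, Nat.sub_add_cancel hj']
      rw [e, coeff_mul_monomial]
      rfl
    rw [Finset.sum_congr rfl key, Finset.sum_range_succ, add_comm] at h
    have hlead : (P.coeff P.natDegree : R[X]) = 1 := by
      have : P.coeff P.natDegree = 1 := hP
      rw [this]; rfl
    rw [hlead] at h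
    simp only [Nat.sub_self, mul_zero, coeff_one_zero, one_mul] at h
    rw [← h]
    congr 1
    refine Finset.sum_bij' (fun i _ => P.natDegree - i) (fun j _ => P.natDegree - j)
      ?_ ?_ ?_ ?_ ?_
    · intro i hi; simp only [Finset.mem_Icc, Finset.mem_range] at *; omega
    · intro i hi; simp only [Finset.mem_Icc, Finset.mem_range] at *; omega
    · intro i hi; simp only [Finset.mem_Icc] at *; omega
    · intro i hi; simp only [Finset.mem_range] at *; omega
    · intro i hi
      simp only [Finset.mem_Icc] at hi
      have : P.natDegree - (P.natDegree - i) = i := by omega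
      simp only [this]
  · rintro ⟨n, c, hc, hx⟩
    let C' : ℕ → reesAlgebra I := fun i =>
      ⟨monomial (k * i) (c i), reesAlgebra.monomial_mem.mpr (hc i)⟩
    refine ⟨X ^ n + ∑ i ∈ Finset.Icc 1 n, C (C' i) * X ^ (n - i), ?_, ?_⟩
    · rcases subsingleton_or_nontrivial (reesAlgebra I) with hs | hs
      · exact Subsingleton.elim _ _
      apply monic_X_pow_add
      refine lt_of_le_of_lt (degree_sum_le _ _) ?_
      refine (Finset.sup_lt_iff (WithBot.bot_lt_coe n)).mpr ?_
      intro i hi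
      refine lt_of_le_of_lt (degree_C_mul_X_pow_le _ _) ?_
      simp only [Finset.mem_Icc] at hi
      exact WithBot.coe_lt_coe.mpr (by omega : n - i < n)
    · simp only [eval₂_add, eval₂_pow, eval₂_X, eval₂_finsetSum, eval₂_mul, eval₂_C]
      have key : ∀ i ∈ Finset.Icc 1 n, (algebraMap (reesAlgebra I) R[X]) (C' i) *
          (monomial k x) ^ (n - i) = monomial (k * n) (c i * x ^ (n - i)) := by
        intro i hi
        simp only [Finset.mem_Icc] at hi
        have e : k * n = k * i + k * (n - i) := by
          rw [← mul_add]; congr 1; omega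
        rw [monomial_pow, e, ← monomial_mul_monomial]
        rfl
      rw [Finset.sum_congr rfl key, monomial_pow, ← map_sum, ← map_add, hx, map_zero]

theorem isIntegral_rees_one_iff {R : Type*} [CommRing R] (I : Ideal R) (x : R) :
    IsIntegral (reesAlgebra I) (monomial 1 x) ↔
      ∃ (n : ℕ) (c : ℕ → R), (∀ i, c i ∈ I ^ i) ∧
        x ^ n + ∑ i ∈ Finset.Icc 1 n, c i * x ^ (n - i) = 0 := by
  rw [isIntegral_rees_iff]
  simp only [IsWeightIntegral, one_mul]

/-- The integral closure of an ideal `I`: all `x` that satisfy an equation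
`x ^ n + c₁ x ^ (n - 1) + ⋯ + cₙ = 0` with `cᵢ ∈ I ^ i`. -/
def idealClosure {R : Type*} [CommRing R] (I : Ideal R) : Ideal R where
  carrier := {x | ∃ (n : ℕ) (c : ℕ → R), (∀ i, c i ∈ I ^ i) ∧
    x ^ n + ∑ i ∈ Finset.Icc 1 n, c i * x ^ (n - i) = 0}
  add_mem' {x y} hx hy := by
    simp only [Set.mem_ofPred_eq, ← isIntegral_rees_one_iff] at *
    rw [map_add]
    exact hx.add hy
  zero_mem' := by
    simp only [Set.mem_ofPred_eq, ← isIntegral_rees_one_iff, map_zero]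
    exact isIntegral_zero
  smul_mem' r x hx := by
    simp only [Set.mem_ofPred_eq, ← isIntegral_rees_one_iff] at *
    have h : monomial 1 (r • x) = algebraMap (reesAlgebra I) R[X]
        (algebraMap R (reesAlgebra I) r) * monomial 1 x := by
      change _ = (C r : R[X]) * _
      rw [C_mul_monomial, smul_eq_mul]
    rw [h]
    exact isIntegral_algebraMap.mul hx

theorem mem_idealClosure_iff {R : Type*} [CommRing R] {I : Ideal R} {x : R} :
    x ∈ idealClosure I ↔ IsIntegral (reesAlgebra I) (monomial 1 x) :=
  (isIntegral_rees_one_iff I x).symm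

theorem le_idealClosure {R : Type*} [CommRing R] (I : Ideal R) : I ≤ idealClosure I := by
  intro x hx
  rw [mem_idealClosure_iff]
  exact isIntegral_algebraMap (x := (⟨monomial 1 x, reesAlgebra.monomial_mem.mpr
    (by rwa [pow_one])⟩ : reesAlgebra I))

theorem idealClosure_le {R : Type*} [CommRing R] {I J : Ideal R} (h : I ≤ idealClosure J) :
    idealClosure I ≤ idealClosure J := by
  intro x hx
  rw [mem_idealClosure_iff] at *
  have hsub : ∀ f ∈ reesAlgebra I, IsIntegral (reesAlgebra J) f := by
    intro f hf
    rw [← adjoin_monomial_eq_reesAlgebra] at hf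
    have hle : Algebra.adjoin R (Submodule.map (monomial 1 : R →ₗ[R] R[X]) I : Set R[X]) ≤
        (integralClosure (reesAlgebra J) R[X]).restrictScalars R := by
      apply Algebra.adjoin_le
      rintro _ ⟨r, hr, rfl⟩
      exact mem_idealClosure_iff.mp (h hr)
    exact hle hf
  let A := integralClosure (reesAlgebra J) R[X]
  have hA : IsIntegral A (monomial 1 x : R[X]) := by
    obtain ⟨P, hP, hx⟩ := hx
    let g : reesAlgebra I →+* A :=
      { toFun := fun f => ⟨f.1, hsub f.1 f.2⟩
        map_one' := rfl
        map_mul' := fun _ _ => rfl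
        map_zero' := rfl
        map_add' := fun _ _ => rfl }
    refine ⟨P.map g, hP.map g, ?_⟩
    rw [eval₂_map]
    exact hx
  exact isIntegral_trans (R := reesAlgebra J) (A := A) _ hA

theorem mem_idealClosure_of_pow {R : Type*} [CommRing R] {I : Ideal R} {x : R} {k : ℕ}
    (hk : 0 < k) (h : x ^ k ∈ idealClosure (I ^ k)) : x ∈ idealClosure I := by
  rw [mem_idealClosure_iff]
  obtain ⟨n, c, hc, hx⟩ := h
  have h' : IsWeightIntegral I k (x ^ k) := ⟨n, c, fun i => by rw [pow_mul]; exact hc i, hx⟩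
  rw [← isIntegral_rees_iff] at h'
  apply IsIntegral.of_pow hk
  rwa [monomial_pow, one_mul]

theorem le_idealClosure_of_pow {R : Type*} [CommRing R] {I J : Ideal R} {k : ℕ}
    (hk : 0 < k) (h : I ^ k ≤ idealClosure (J ^ k)) : I ≤ idealClosure J :=
  fun _ hx => mem_idealClosure_of_pow hk (h (Ideal.pow_mem_pow hx k))

theorem map_idealClosure_le {R S : Type*} [CommRing R] [CommRing S] (φ : R →+* S)
    (I : Ideal R) : (idealClosure I).map φ ≤ idealClosure (I.map φ) := by
  rw [Ideal.map_le_iff_le_comap]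
  rintro x ⟨n, c, hc, hx⟩
  refine ⟨n, fun i => φ (c i), fun i => ?_, ?_⟩
  · rw [← Ideal.map_pow]
    exact Ideal.mem_map_of_mem φ (hc i)
  · simpa using congrArg φ hx

/-! ### `ℚ`-ideals -/

/-- Symbols `J ^ q`, with `J` an ideal and `q` a positive rational number. (A symbol `J ^ 0` with
`J` nonzero is equivalent to `(1) ^ 1`, and `(0) ^ 0` is by convention the same as `(0) ^ 1`,
so that restricting to positive exponents does not change the set of equivalence classes.) -/
structure QSymbol (R : Type*) [CommRing R] where
  ideal : Ideal R
  exp : ℚ≥0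
  exp_pos : 0 < exp

namespace QSymbol

variable {R S : Type*} [CommRing R] [CommRing S]

/-- `J₁ ^ q₁ ≤ J₂ ^ q₂` if for every positive integer `m` with `m q₁` and `m q₂` integers,
`J₁ ^ (m q₁)` is contained in the integral closure of `J₂ ^ (m q₂)`. -/
protected def LE (s t : QSymbol R) : Prop :=
  ∀ m n₁ n₂ : ℕ, 0 < m → (m : ℚ≥0) * s.exp = n₁ → (m : ℚ≥0) * t.exp = n₂ →
    s.ideal ^ n₁ ≤ idealClosure (t.ideal ^ n₂)

/-- `J₁ ^ q₁` and `J₂ ^ q₂` are equivalent if for every positive integer `m` with `m q₁` and `m q₂`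
integers, `J₁ ^ (m q₁)` and `J₂ ^ (m q₂)` have the same integral closure. -/
protected def Equiv (s t : QSymbol R) : Prop :=
  ∀ m n₁ n₂ : ℕ, 0 < m → (m : ℚ≥0) * s.exp = n₁ → (m : ℚ≥0) * t.exp = n₂ →
    idealClosure (s.ideal ^ n₁) = idealClosure (t.ideal ^ n₂)

theorem equiv_iff {s t : QSymbol R} : s.Equiv t ↔ s.LE t ∧ t.LE s := by
  constructor
  · intro h
    refine ⟨fun m n₁ n₂ hm h₁ h₂ => ?_, fun m n₁ n₂ hm h₁ h₂ => ?_⟩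
    · exact (le_idealClosure _).trans (h m n₁ n₂ hm h₁ h₂).le
    · exact (le_idealClosure _).trans (h m n₂ n₁ hm h₂ h₁).ge
  · rintro ⟨h, h'⟩ m n₁ n₂ hm h₁ h₂
    exact le_antisymm (idealClosure_le (h m n₁ n₂ hm h₁ h₂))
      (idealClosure_le (h' m n₂ n₁ hm h₂ h₁))

protected theorem LE.refl (s : QSymbol R) : s.LE s := by
  intro m n₁ n₂ _ h₁ h₂
  have : n₁ = n₂ := by exact_mod_cast h₁.symm.trans h₂
  rw [this]
  exact le_idealClosure _

protected theorem LE.trans {s t u : QSymbol R} (h : s.LE t) (h' : t.LE u) : s.LE u := by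
  intro m n₁ n₃ hm h₁ h₃
  have hk : 0 < t.exp.den := t.exp.den_pos
  have e₂ : ((m * t.exp.den : ℕ) : ℚ≥0) * t.exp = (m * t.exp.num : ℕ) := by
    push_cast
    rw [mul_assoc, NNRat.den_mul_eq_num]
  have e₁ : ((m * t.exp.den : ℕ) : ℚ≥0) * s.exp = (n₁ * t.exp.den : ℕ) := by
    push_cast
    rw [← h₁]; ring
  have e₃ : ((m * t.exp.den : ℕ) : ℚ≥0) * u.exp = (n₃ * t.exp.den : ℕ) := by
    push_cast
    rw [← h₃]; ring
  have hm' : 0 < m * t.exp.den := Nat.mul_pos hm hk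
  refine le_idealClosure_of_pow hk ?_
  rw [← pow_mul, ← pow_mul]
  exact (h _ _ _ hm' e₁ e₂).trans (idealClosure_le (h' _ _ _ hm' e₂ e₃))

/-- The equivalence relation on symbols. -/
instance setoid (R : Type*) [CommRing R] : Setoid (QSymbol R) where
  r := QSymbol.Equiv
  iseqv :=
    { refl := fun s => equiv_iff.mpr ⟨LE.refl s, LE.refl s⟩
      symm := fun h => equiv_iff.mpr (equiv_iff.mp h).symm
      trans := fun h h' => by
        rw [equiv_iff] at *
        exact ⟨h.1.trans h'.1, h'.2.trans h.2⟩ }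

/-- Pull-back of a symbol along a ring homomorphism: `J ^ q` goes to `(J S) ^ q`. -/
def map (φ : R →+* S) (s : QSymbol R) : QSymbol S :=
  ⟨s.ideal.map φ, s.exp, s.exp_pos⟩

theorem LE.map (φ : R →+* S) {s t : QSymbol R} (h : s.LE t) : (s.map φ).LE (t.map φ) := by
  intro m n₁ n₂ hm h₁ h₂
  change (s.ideal.map φ) ^ n₁ ≤ idealClosure ((t.ideal.map φ) ^ n₂)
  rw [← Ideal.map_pow, ← Ideal.map_pow]
  exact (Ideal.map_mono (h m n₁ n₂ hm h₁ h₂)).trans (map_idealClosure_le φ _)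

/-- Rational powers of a symbol: `(J ^ q) ^ r = J ^ (q r)`. -/
def pow (r : ℚ≥0) (hr : 0 < r) (s : QSymbol R) : QSymbol R :=
  ⟨s.ideal, s.exp * r, mul_pos s.exp_pos hr⟩

theorem LE.pow (r : ℚ≥0) (hr : 0 < r) {s t : QSymbol R} (h : s.LE t) :
    (s.pow r hr).LE (t.pow r hr) := by
  intro m n₁ n₂ hm h₁ h₂
  simp only [QSymbol.pow] at *
  have hd : r * r.den = r.num := NNRat.mul_den_eq_num r
  have hnum : 0 < r.num := by
    have := NNRat.num_ne_zero.mpr hr.ne'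
    omega
  refine le_idealClosure_of_pow r.den_pos ?_
  rw [← pow_mul, ← pow_mul]
  refine h (m * r.num) _ _ (Nat.mul_pos hm hnum) ?_ ?_
  · push_cast
    rw [← h₁, ← hd]; ring
  · push_cast
    rw [← h₂, ← hd]; ring

end QSymbol

/-- `ℚ`-ideals in a ring: equivalence classes of symbols `J ^ q`. -/
def QIdeal (R : Type*) [CommRing R] : Type _ := Quotient (QSymbol.setoid R)

namespace QIdeal

variable {R S : Type*} [CommRing R] [CommRing S]

/-- The order relation on `ℚ`-ideals. -/
instance : LE (QIdeal R) where
  le := Quotient.lift₂ QSymbol.LE (by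
    intro s t s' t' h h'
    obtain ⟨h₁, h₂⟩ := QSymbol.equiv_iff.mp h
    obtain ⟨h₁', h₂'⟩ := QSymbol.equiv_iff.mp h'
    exact propext ⟨fun k => (h₂.trans k).trans h₁', fun k => (h₁.trans k).trans h₂'⟩)

/-- The pull-back of a `ℚ`-ideal along a ring homomorphism. -/
def map (φ : R →+* S) : QIdeal R → QIdeal S :=
  Quotient.map (QSymbol.map φ) (by
    intro s t h
    obtain ⟨h₁, h₂⟩ := QSymbol.equiv_iff.mp h
    exact QSymbol.equiv_iff.mpr ⟨h₁.map φ, h₂.map φ⟩)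

/-- Positive rational powers of a `ℚ`-ideal. -/
def pow (𝔞 : QIdeal R) (r : ℚ≥0) (hr : 0 < r) : QIdeal R :=
  Quotient.map (QSymbol.pow r hr) (by
    intro s t h
    obtain ⟨h₁, h₂⟩ := QSymbol.equiv_iff.mp h
    exact QSymbol.equiv_iff.mpr ⟨h₁.pow r hr, h₂.pow r hr⟩) 𝔞

end QIdeal

/-! ### Orders in `K⟦t^{1/N}⟧`

An element of `K⟦t^{1/N}⟧` is written as `f(t^{1/N})` with `f : PowerSeries K`, so that
`K⟦t^{1/N}⟧` is the ring `PowerSeries K` in the variable `t^{1/N}`, and `K⟦t⟧` is embedded in it by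
`PowerSeries.expand N`, which replaces the variable by its `N`-th power. -/

noncomputable section

variable {K : Type*} [Field K]

/-- The order in `t` of the element `f(t^{1/N})` of `K⟦t^{1/N}⟧`, with `ord 0 = ∞`. -/
def ordT (N : ℕ) (f : PowerSeries K) : ℝ≥0∞ := (f.order : ℝ≥0∞) / N

theorem nsmul_le_order_of_mem_pow {I : Ideal (PowerSeries K)} {e : ℕ∞}
    (he : ∀ y ∈ I, e ≤ y.order) (n : ℕ) : ∀ y ∈ I ^ n, n • e ≤ y.order := by
  induction n with
  | zero => simp
  | succ n ih =>
    intro y hy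
    rw [pow_succ] at hy
    refine Submodule.mul_induction_on hy ?_ ?_
    · intro a ha b hb
      rw [succ_nsmul]
      exact (add_le_add (ih a ha) (he b hb)).trans (PowerSeries.le_order_mul a b)
    · intro a b ha hb
      exact (le_min ha hb).trans (PowerSeries.min_order_le_order_add a b)

theorem order_sum_ge {ι : Type*} (s : Finset ι) (f : ι → PowerSeries K) (e : ℕ∞)
    (h : ∀ i ∈ s, e ≤ (f i).order) : e ≤ (∑ i ∈ s, f i).order := by
  classical
  induction s using Finset.induction_on with
  | empty => simp
  | insert a s ha ih =>
    rw [Finset.sum_insert ha]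
    refine le_trans (le_min (h _ (Finset.mem_insert_self _ _))
      (ih fun i hi => h i (Finset.mem_insert_of_mem hi))) (PowerSeries.min_order_le_order_add _ _)

theorem le_order_of_mem_idealClosure {I : Ideal (PowerSeries K)} {e : ℕ∞}
    (he : ∀ y ∈ I, e ≤ y.order) {x : PowerSeries K} (hx : x ∈ idealClosure I) :
    e ≤ x.order := by
  by_contra hlt
  rw [not_le] at hlt
  obtain ⟨n, c, hc, hx⟩ := hx
  obtain ⟨a, ha⟩ := ENat.ne_top_iff_exists.mp hlt.ne_top
  have hxn : (x ^ n).order = (n * a : ℕ) := by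
    rw [PowerSeries.order_pow, ← ha]; simp
  have h1 : ((n * a + 1 : ℕ) : ℕ∞) ≤ (x ^ n).order := by
    rw [eq_neg_of_add_eq_zero_left hx, PowerSeries.order_neg]
    apply order_sum_ge
    intro i hi
    simp only [Finset.mem_Icc] at hi
    have h2 : ((a + 1 : ℕ) : ℕ∞) ≤ e := by
      rw [← ha] at hlt
      push_cast
      exact Order.add_one_le_of_lt hlt
    have h3 := nsmul_le_order_of_mem_pow (fun y hy => h2.trans (he y hy)) i (c i) (hc i)
    rw [PowerSeries.order_mul, PowerSeries.order_pow, ← ha]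
    refine le_trans ?_ (add_le_add_left h3 _)
    simp only [nsmul_eq_mul]
    norm_cast
    obtain ⟨j, rfl⟩ := Nat.exists_eq_add_of_le hi.2
    have : i + j - i = j := by omega
    rw [this]
    nlinarith
  rw [hxn] at h1
  have : n * a + 1 ≤ n * a := by exact_mod_cast h1
  omega

/-- The order of the ideal `J` in the variable of the power series ring. -/
def idealOrd (J : Ideal (PowerSeries K)) : ℕ∞ := ⨅ f ∈ J, PowerSeries.order f

theorem exists_order_eq_idealOrd (J : Ideal (PowerSeries K)) :
    ∃ f ∈ J, PowerSeries.order f = idealOrd J := by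
  have h : sInf ((fun f : PowerSeries K => f.order) '' (J : Set (PowerSeries K))) ∈
      ((fun f : PowerSeries K => f.order) '' (J : Set (PowerSeries K))) :=
    csInf_mem (Set.Nonempty.image _ ⟨0, J.zero_mem⟩)
  obtain ⟨f, hf, h⟩ := h
  refine ⟨f, hf, ?_⟩
  refine Eq.trans h ?_
  rw [sInf_image]
  rfl

/-- The order in `t` of the symbol `J ^ q` in `K⟦t^{1/N}⟧`. -/
def QSymbol.ord (N : ℕ) (s : QSymbol (PowerSeries K)) : ℝ≥0∞ :=
  ((s.exp : ℝ≥0) : ℝ≥0∞) * (((idealOrd s.ideal : ℕ∞) : ℝ≥0∞) / N)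

theorem QSymbol.LE.ord_le (N : ℕ) {s t : QSymbol (PowerSeries K)} (h : s.LE t) :
    t.ord N ≤ s.ord N := by
  obtain ⟨f, hf, hfo⟩ := exists_order_eq_idealOrd s.ideal
  set m := s.exp.den * t.exp.den with hm
  have hm0 : 0 < m := Nat.mul_pos s.exp.den_pos t.exp.den_pos
  have e₁ : (m : ℚ≥0) * s.exp = (s.exp.num * t.exp.den : ℕ) := by
    rw [hm]; push_cast; rw [mul_right_comm, NNRat.den_mul_eq_num]
  have e₂ : (m : ℚ≥0) * t.exp = (s.exp.den * t.exp.num : ℕ) := by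
    rw [hm]; push_cast; rw [mul_assoc, NNRat.den_mul_eq_num]
  have h1 := h m _ _ hm0 e₁ e₂ (Ideal.pow_mem_pow hf _)
  have h2 : ∀ y ∈ t.ideal, idealOrd t.ideal ≤ y.order := fun y hy => iInf₂_le y hy
  have h3 := le_order_of_mem_idealClosure (nsmul_le_order_of_mem_pow h2 _) h1
  rw [PowerSeries.order_pow, hfo] at h3
  generalize s.exp.num * t.exp.den = n₁ at *
  generalize s.exp.den * t.exp.num = n₂ at *
  have h4 : (n₂ : ℝ≥0∞) * (idealOrd t.ideal : ℝ≥0∞) ≤ n₁ * (idealOrd s.ideal : ℝ≥0∞) := by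
    have := ENat.toENNReal_le.mpr h3
    simpa [nsmul_eq_mul] using this
  have c₁ : (n₁ : ℝ≥0∞) = m * ((s.exp : ℝ≥0) : ℝ≥0∞) := by
    have : (n₁ : ℝ≥0) = m * (s.exp : ℝ≥0) := by exact_mod_cast e₁.symm
    exact_mod_cast congrArg (fun x : ℝ≥0 => (x : ℝ≥0∞)) this
  have c₂ : (n₂ : ℝ≥0∞) = m * ((t.exp : ℝ≥0) : ℝ≥0∞) := by
    have : (n₂ : ℝ≥0) = m * (t.exp : ℝ≥0) := by exact_mod_cast e₂.symm
    exact_mod_cast congrArg (fun x : ℝ≥0 => (x : ℝ≥0∞)) this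
  rw [c₁, c₂, mul_assoc, mul_assoc, ENNReal.mul_le_mul_iff_right (by exact_mod_cast hm0.ne')
    (ENNReal.natCast_ne_top m)] at h4
  simp only [QSymbol.ord, ← mul_div_assoc]
  exact ENNReal.div_le_div_right h4 _

/-- The order in `t` of a `ℚ`-ideal in `K⟦t^{1/N}⟧`, a nonnegative rational number or `∞`; the
order of `(t) ^ q` is `q`, and the order of the zero ideal is `∞`. -/
def QIdeal.ord (N : ℕ) : QIdeal (PowerSeries K) → ℝ≥0∞ :=
  Quotient.lift (QSymbol.ord N) (by
    intro s t h
    obtain ⟨h₁, h₂⟩ := QSymbol.equiv_iff.mp h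
    exact le_antisymm (h₂.ord_le N) (h₁.ord_le N))

/-- For a `ℚ`-ideal `𝔟` in `ℚ[z₁, …, zₙ]` and `u₁, …, uₙ` in a power series ring over `K`, the
`ℚ`-ideal `𝔟(u₁, …, uₙ)`: the pull-back of `𝔟` by `zᵢ ↦ uᵢ`. -/
def QIdeal.evalAt [CharZero K] {n : ℕ} (𝔟 : QIdeal (MvPolynomial (Fin n) ℚ))
    (u : Fin n → PowerSeries K) : QIdeal (PowerSeries K) :=
  𝔟.map (MvPolynomial.aeval u : MvPolynomial (Fin n) ℚ →ₐ[ℚ] PowerSeries K).toRingHom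

/-- The `ℚ`-ideal `𝔟 K[z₁, …, zₙ]` generated by a `ℚ`-ideal `𝔟` in `ℚ[z₁, …, zₙ]`. -/
def QIdeal.baseChange (K : Type*) [Field K] [CharZero K] {n : ℕ}
    (𝔟 : QIdeal (MvPolynomial (Fin n) ℚ)) : QIdeal (MvPolynomial (Fin n) K) :=
  𝔟.map (MvPolynomial.map (algebraMap ℚ K))

/-- Difference of orders, with the convention `∞ - ∞ = ∞`. -/
def ordSub (p m : ℝ≥0∞) : EReal := if p = ⊤ then ⊤ else (p : EReal) - (m : EReal)

/-- The polynomial `y ^ d + a₁ y ^ (d - 1) + ⋯ + a_d`. -/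
def monicPoly {A : Type*} [CommRing A] {d : ℕ} (a : Fin d → A) : A[X] :=
  X ^ d + ∑ i : Fin d, C (a i) * X ^ (d - 1 - (i : ℕ))

/-- The elements `α₁, …, α_d` of `K⟦t^{1/N}⟧` are the roots, listed with multiplicity, of
`y ^ d + a₁ y ^ (d - 1) + ⋯ + a_d`, where `a₁, …, a_d` are in `K⟦t⟧`. -/
def AreRoots (N : ℕ) (hN : N ≠ 0) {d : ℕ} (a α : Fin d → PowerSeries K) : Prop :=
  monicPoly (fun i => PowerSeries.expand N hN (a i)) = ∏ i : Fin d, (X - C (α i))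

/-- The minimum of `ord ∏ (α_{j_ℓ} - w)`, `1 ≤ ℓ ≤ k`, over distinct `j₁, …, j_k`. -/
def minOrdProd (N : ℕ) {d : ℕ} (k : ℕ) (α : Fin d → PowerSeries K) (w : PowerSeries K) : ℝ≥0∞ :=
  ⨅ j : Fin k ↪ Fin d, ordT N (∏ l : Fin k, (α (j l) - w))

end

/-- The exponent `d / (d - 1)` is positive for `d ≥ 2`. -/
theorem exponent_pos {d : ℕ} (hd : 2 ≤ d) : (0 : ℚ≥0) < (d : ℚ≥0) / ((d - 1 : ℕ) : ℚ≥0) :=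
  div_pos (by exact_mod_cast (by omega : 0 < d)) (by exact_mod_cast (by omega : 0 < d - 1))

/-! Write `β i` for the order of the given ideal at `(a, αᵢ)`. A maximum is a total minus the
smallest sum that omits one term: `max β = ∑ β - min_i ∑_{j ≠ i} β j`. Both quantities on the right
are orders of ideals in the coefficients.

With generators `f₀, …, f_{m-1}` of the ideal and a new variable `s`, put `Fᵢ = ∑ⱼ sʲ fⱼ(a, xᵢ)`.
Powers of `s` prevent cancellation, so `Fᵢ` at the roots has order `β i` in `K[s]⟦t^{1/N}⟧`
(`order_eval₂_genericAtRoot`), where orders are additive on products. The product of all `Fᵢ` is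
symmetric, hence a polynomial in `a` over `ℚ[s]`, and its `s`-coefficients generate `P` of order `∑
β` (`order_eval₂_constPoly`). For the minimum, take the products `Gᵢ` of all `Fⱼ` but one: the least
order in a finite family is the least of `ord(e_r) / r` over its elementary symmetric functions
(`iInf_order_familyEsymm`), and these are again polynomials in `a`. Raising them to the powers `d! /
r` gives an ideal of order `d! · min`.

The least of the `d` sums is at most their average `(d - 1) / d · ∑ β`, so a suitable power of `P`
can be added to this ideal without changing any order; the inequality with exponent `d / (d - 1)`
then becomes a plain inclusion.

The combination of minima in the first statement is the order of one `ℚ`-ideal at `(a, αᵢ)`,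
obtained by the same device from the products of `αⱼ - w` (`exists_ideal_iInf_order_prod_sub`), so
it is a special case of the second. -/

/-! ### Elementary symmetric functions of a finite family -/

/-- The `r`-th elementary symmetric function of a finite family. -/
def familyEsymm {T A : Type*} [Fintype T] [CommRing A] (φ : T → A) (r : ℕ) : A :=
  ∑ U ∈ Finset.powersetCard r (Finset.univ : Finset T), ∏ τ ∈ U, φ τ

section FamilyEsymm

variable {T A B : Type*} [Fintype T] [CommRing A] [CommRing B]

theorem map_familyEsymm (f : A →+* B) (φ : T → A) (r : ℕ) :
    f (familyEsymm φ r) = familyEsymm (fun τ => f (φ τ)) r := by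
  simp [familyEsymm, map_sum, map_prod]

theorem familyEsymm_comp_equiv (φ : T → A) (e : T ≃ T) (r : ℕ) :
    familyEsymm (fun τ => φ (e τ)) r = familyEsymm φ r := by
  have h : ∀ ψ : T → A, familyEsymm ψ r = MvPolynomial.aeval ψ (MvPolynomial.esymm T ℤ r) := by
    intro ψ
    simp [familyEsymm, MvPolynomial.esymm, map_sum, map_prod]
  have h' := MvPolynomial.aeval_rename (R := ℤ) e φ (MvPolynomial.esymm T ℤ r)
  rw [MvPolynomial.rename_esymm] at h'
  rw [h, h, h']
  rfl

end FamilyEsymm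

section FamilyOrder

variable {T D : Type*} [Fintype T] [CommRing D] [IsDomain D]

theorem PowerSeries.le_order_sum {D ι : Type*} [CommRing D] (s : Finset ι)
    (f : ι → PowerSeries D) (e : ℕ∞) (h : ∀ i ∈ s, e ≤ (f i).order) :
    e ≤ (∑ i ∈ s, f i).order := by
  classical
  induction s using Finset.induction_on with
  | empty => simp
  | insert a s ha ih =>
    rw [Finset.sum_insert ha]
    exact le_trans (le_min (h _ (Finset.mem_insert_self _ _))
      (ih fun i hi => h i (Finset.mem_insert_of_mem hi))) (PowerSeries.min_order_le_order_add _ _)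

theorem le_order_familyEsymm (φ : T → PowerSeries D) (r : ℕ) {m : ℕ∞}
    (hm : ∀ τ, m ≤ (φ τ).order) : r * m ≤ (familyEsymm φ r).order := by
  refine PowerSeries.le_order_sum _ _ _ fun U hU => ?_
  rw [PowerSeries.order_prod]
  rw [Finset.mem_powersetCard] at hU
  calc (r : ℕ∞) * m = ∑ _τ ∈ U, m := by rw [Finset.sum_const, hU.2, nsmul_eq_mul]
    _ ≤ _ := Finset.sum_le_sum fun τ _ => hm τ

/-- The smallest order in a finite family is detected by an elementary symmetric function: the one
whose index is the number of members of smallest order. -/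
theorem exists_order_familyEsymm [Nonempty T] (φ : T → PowerSeries D) :
    ∃ r, 1 ≤ r ∧ r ≤ Fintype.card T ∧ (familyEsymm φ r).order = r * ⨅ τ, (φ τ).order := by
  classical
  set m := ⨅ τ, (φ τ).order with hm
  have hle : ∀ τ, m ≤ (φ τ).order := fun τ => iInf_le _ τ
  obtain ⟨τ₀, hτ₀⟩ := ENat.exists_eq_iInf fun τ => (φ τ).order
  -- If all orders are infinite, any index works.
  by_cases htop : m = ⊤
  · refine ⟨1, le_rfl, Fintype.card_pos, le_antisymm (by simp [htop]) ?_⟩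
    exact le_order_familyEsymm φ 1 hle
  obtain ⟨n, hn⟩ := ENat.ne_top_iff_exists.mp htop
  set U₀ := Finset.univ.filter fun τ => (φ τ).order = m with hU₀
  refine ⟨U₀.card, Finset.card_pos.mpr ⟨τ₀, by simp [hU₀, hm, hτ₀]⟩, Finset.card_le_univ _, ?_⟩
  have hmem : U₀ ∈ Finset.powersetCard U₀.card (Finset.univ : Finset T) := by simp
  have h₀ : (∏ τ ∈ U₀, φ τ).order = U₀.card * m := by
    rw [PowerSeries.order_prod, Finset.sum_congr rfl (g := fun _ => m), Finset.sum_const,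
      nsmul_eq_mul]
    intro τ hτ
    simpa [hU₀] using hτ
  -- Any other subset of the same size contains a member outside `U₀`, whose order exceeds `m`, so
  -- the term of `U₀` cannot be cancelled.
  have h₁ : U₀.card * m + 1 ≤ (∑ U ∈ (Finset.powersetCard U₀.card Finset.univ).erase U₀,
      ∏ τ ∈ U, φ τ).order := by
    refine PowerSeries.le_order_sum _ _ _ fun U hU => ?_
    obtain ⟨hne, hU⟩ := Finset.mem_erase.mp hU
    obtain ⟨-, hcard⟩ := Finset.mem_powersetCard.mp hU
    obtain ⟨τ, hτU, hτ⟩ : ∃ τ ∈ U, τ ∉ U₀ := by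
      by_contra! h
      exact hne (Finset.eq_of_subset_of_card_le h hcard.ge)
    have hlt : m + 1 ≤ (φ τ).order := by
      refine Order.add_one_le_of_lt (lt_of_le_of_ne (hle τ) fun h => hτ ?_)
      simp [hU₀, ← h]
    rw [PowerSeries.order_prod, ← Finset.add_sum_erase _ _ hτU, ← hcard,
      ← Finset.card_erase_add_one hτU]
    push_cast
    calc ((U.erase τ).card + 1 : ℕ∞) * m + 1 = (m + 1) + ∑ _x ∈ U.erase τ, m := by
          rw [Finset.sum_const, nsmul_eq_mul]; ring
      _ ≤ _ := add_le_add hlt (Finset.sum_le_sum fun x _ => hle x)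
  have hlt : (U₀.card : ℕ∞) * m < U₀.card * m + 1 := by
    rw [← hn]; norm_cast; omega
  rw [familyEsymm, ← Finset.add_sum_erase _ _ hmem, PowerSeries.order_add_of_order_ne _ _
    (by rw [h₀]; exact (hlt.trans_le h₁).ne), h₀]
  exact inf_eq_left.mpr (hlt.le.trans h₁)

/-- The weights `n! / r` replace the quotients `ord(e_r) / r` by integers with the common
denominator `n!`. -/
theorem cast_factorial_div_mul {n r : ℕ} (hr : 1 ≤ r) (hrn : r ≤ n) :
    ((n.factorial / r : ℕ) : ℕ∞) * r = n.factorial := by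
  exact_mod_cast Nat.div_mul_cancel (Nat.dvd_factorial hr hrn)

/-- The smallest order in a finite family, in terms of its elementary symmetric functions. -/
theorem iInf_order_familyEsymm [Nonempty T] (φ : T → PowerSeries D) {n : ℕ}
    (hn : Fintype.card T = n) :
    ⨅ r : Fin n, (n.factorial / (r + 1 : ℕ) : ℕ) * (familyEsymm φ (r + 1)).order =
      n.factorial * ⨅ τ, (φ τ).order := by
  apply le_antisymm
  · obtain ⟨r, hr, hrn, h⟩ := exists_order_familyEsymm φ
    rw [hn] at hrn
    refine (iInf_le _ ⟨r - 1, by omega⟩).trans ?_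
    simp only [Nat.sub_add_cancel hr]
    rw [h, ← mul_assoc, cast_factorial_div_mul hr hrn]
  · refine le_iInf fun r => ?_
    rw [← cast_factorial_div_mul (n := n) (r := r + 1) (by omega) (by omega), mul_assoc]
    gcongr
    exact le_order_familyEsymm φ _ fun τ => iInf_le _ τ

end FamilyOrder

/-! ### Orders of ideals -/

section IdealOrd

variable {K : Type*} [Field K]

theorem le_idealOrd_iff {J : Ideal (PowerSeries K)} {e : ℕ∞} :
    e ≤ idealOrd J ↔ ∀ f ∈ J, e ≤ f.order := by
  simp [idealOrd]

/-- The series of order at least `e` form an ideal, so generators suffice. -/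
theorem le_idealOrd_span_iff {s : Set (PowerSeries K)} {e : ℕ∞} :
    e ≤ idealOrd (Ideal.span s) ↔ ∀ f ∈ s, e ≤ f.order := by
  rw [le_idealOrd_iff]
  refine ⟨fun h f hf => h f (Ideal.subset_span hf), fun h f hf => ?_⟩
  refine Submodule.span_induction h (by simp) ?_ ?_ hf
  · intro a b _ _ ha hb
    exact (le_min ha hb).trans (PowerSeries.min_order_le_order_add a b)
  · intro a b _ hb
    rw [smul_eq_mul, PowerSeries.order_mul]
    exact hb.trans le_add_self

theorem idealOrd_span_range {ι : Sort*} (f : ι → PowerSeries K) :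
    idealOrd (Ideal.span (Set.range f)) = ⨅ i, (f i).order := by
  refine eq_of_forall_le_iff fun e => ?_
  simp [le_idealOrd_span_iff]

theorem idealOrd_sup (I J : Ideal (PowerSeries K)) :
    idealOrd (I ⊔ J) = min (idealOrd I) (idealOrd J) := by
  refine eq_of_forall_le_iff fun e => ?_
  conv_lhs => rw [← Ideal.span_eq I, ← Ideal.span_eq J, ← Ideal.span_union, le_idealOrd_span_iff]
  simp only [le_min_iff, le_idealOrd_iff, Set.mem_union, SetLike.mem_coe, or_imp, forall_and]

theorem idealOrd_iSup {ι : Sort*} (I : ι → Ideal (PowerSeries K)) :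
    idealOrd (⨆ i, I i) = ⨅ i, idealOrd (I i) := by
  refine eq_of_forall_le_iff fun e => ?_
  have h : (⨆ i, I i) = Ideal.span (⋃ i, (I i : Set (PowerSeries K))) := by
    rw [Ideal.span_iUnion]; simp
  rw [h, le_idealOrd_span_iff]
  simp only [Set.mem_iUnion, SetLike.mem_coe, le_iInf_iff, le_idealOrd_iff]
  exact ⟨fun h i f hf => h f ⟨i, hf⟩, fun h f ⟨i, hf⟩ => h i f hf⟩

/-- Both infima are attained, and the product of two minimizers has the sum of their orders. -/
theorem idealOrd_mul (I J : Ideal (PowerSeries K)) :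
    idealOrd (I * J) = idealOrd I + idealOrd J := by
  apply le_antisymm
  · obtain ⟨f, hf, hfo⟩ := exists_order_eq_idealOrd I
    obtain ⟨g, hg, hgo⟩ := exists_order_eq_idealOrd J
    rw [← hfo, ← hgo, ← PowerSeries.order_mul]
    exact le_idealOrd_iff.mp le_rfl _ (Ideal.mul_mem_mul hf hg)
  · rw [le_idealOrd_iff]
    intro y hy
    refine Submodule.mul_induction_on hy (fun a ha b hb => ?_) fun a b ha hb =>
      (le_min ha hb).trans (PowerSeries.min_order_le_order_add a b)
    rw [PowerSeries.order_mul]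
    exact add_le_add (le_idealOrd_iff.mp le_rfl _ ha) (le_idealOrd_iff.mp le_rfl _ hb)

theorem idealOrd_pow (I : Ideal (PowerSeries K)) (n : ℕ) :
    idealOrd (I ^ n) = n * idealOrd I := by
  induction n with
  | zero =>
    have : idealOrd (⊤ : Ideal (PowerSeries K)) ≤ (1 : PowerSeries K).order :=
      le_idealOrd_iff.mp le_rfl _ Submodule.mem_top
    simpa [Ideal.one_eq_top] using this
  | succ n ih =>
    rw [pow_succ, idealOrd_mul, ih]
    push_cast
    ring

end IdealOrd

/-! ### Power series over polynomials -/

section Swap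

variable {K : Type*} [Field K]

/-- The embedding of `K⟦t⟧[s]` into `K[s]⟦t⟧`. -/
noncomputable def powerSeriesSwap (K : Type*) [Field K] : (PowerSeries K)[X] →+* PowerSeries K[X] :=
  eval₂RingHom (PowerSeries.map C) (PowerSeries.C X)

/-- Both sides are the coefficient of `t ^ m * s ^ n`. -/
theorem coeff_powerSeriesSwap (H : (PowerSeries K)[X]) (m n : ℕ) :
    (PowerSeries.coeff m (powerSeriesSwap K H)).coeff n = PowerSeries.coeff m (H.coeff n) := by
  induction H using Polynomial.induction_on' with
  | add p q hp hq => simp [hp, hq]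
  | monomial k a =>
    rw [powerSeriesSwap, coe_eval₂RingHom, eval₂_monomial, ← map_pow, PowerSeries.coeff_mul_C,
      PowerSeries.coeff_map, coeff_C_mul_X_pow, coeff_monomial]
    by_cases h : n = k
    · simp [h]
    · simp [h, Ne.symm h]

theorem PowerSeries.le_order_iff {D : Type*} [CommRing D] {f : PowerSeries D} {e : ℕ∞} :
    e ≤ f.order ↔ ∀ i : ℕ, (i : ℕ∞) < e → PowerSeries.coeff i f = 0 :=
  ⟨fun h i hi => PowerSeries.coeff_of_lt_order i (hi.trans_le h), PowerSeries.le_order f e⟩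

/-- Gauss: the order of a polynomial over `K⟦t⟧` is the smallest order of a coefficient. -/
theorem order_powerSeriesSwap (H : (PowerSeries K)[X]) :
    (powerSeriesSwap K H).order = ⨅ n, (H.coeff n).order := by
  refine eq_of_forall_le_iff fun e => ?_
  simp only [PowerSeries.le_order_iff, le_iInf_iff, Polynomial.ext_iff,
    coeff_powerSeriesSwap, coeff_zero]
  exact ⟨fun h n i hi => h i hi n, fun h i hi n => h n i hi⟩

end Swap

/-! ### Symmetric polynomials in the roots -/

section Roots

variable {S A B : Type*} [CommRing S] [CommRing A] [CommRing B] {d : ℕ}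

/-- The coefficient `aⱼ₊₁` of the polynomial with roots `x₁, …, x_d`. -/
noncomputable def rootCoeff (S : Type*) [CommRing S] (d : ℕ) (j : Fin d) :
    MvPolynomial (Fin d) S :=
  (-1) ^ (j + 1 : ℕ) * MvPolynomial.esymm (Fin d) S (j + 1)

theorem isSymmetric_rootCoeff (j : Fin d) : (rootCoeff S d j).IsSymmetric := by
  intro e
  simp [rootCoeff, MvPolynomial.rename_esymm]

theorem coeff_monicPoly (a : Fin d → A) (j : Fin d) :
    (monicPoly a).coeff (d - 1 - j) = a j := by
  rw [monicPoly, coeff_add, coeff_X_pow, if_neg (by omega), zero_add, finsetSum_coeff,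
    Finset.sum_eq_single j]
  · simp
  · intro i _ hij
    rw [coeff_C_mul_X_pow, if_neg]
    have := Fin.val_ne_of_ne hij
    omega
  · simp

theorem map_monicPoly (f : A →+* B) (a : Fin d → A) :
    (monicPoly a).map f = monicPoly fun i => f (a i) := by
  simp [monicPoly, Polynomial.map_sum]

/-- Vieta's formulas. The homomorphism `θ` is left free because the coefficient variable of `ℚ[X]`
is later sent either to the independent variable `s` or to a power series `w`. -/
theorem eval₂_rootCoeff (θ : S →+* A) {a α : Fin d → A}
    (h : monicPoly a = ∏ i, (X - C (α i))) (j : Fin d) :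
    MvPolynomial.eval₂ θ α (rootCoeff S d j) = a j := by
  let := θ.toAlgebra
  have h₁ : MvPolynomial.eval₂ θ α (MvPolynomial.esymm (Fin d) S (j + 1)) =
      (Finset.univ.val.map α).esymm (j + 1) :=
    MvPolynomial.aeval_esymm_eq_multiset_esymm (Fin d) S (j + 1) α
  have h₂ := Multiset.prod_X_sub_C_coeff (Finset.univ.val.map α) (k := d - 1 - j) (by simp; omega)
  have h₃ : ((Finset.univ.val.map α).map fun t => X - C t).prod = ∏ i, (X - C (α i)) := by
    rw [Multiset.map_map]; rfl
  have hc : Multiset.card (Finset.univ.val.map α) - (d - 1 - j) = j + 1 := by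
    simp; omega
  rw [h₃, ← h, coeff_monicPoly, hc] at h₂
  rw [h₂, rootCoeff, MvPolynomial.eval₂_mul, h₁]
  congr 1
  rw [← MvPolynomial.coe_eval₂Hom]
  simp

/-- A symmetric polynomial in the roots is a polynomial in the coefficients. -/
theorem exists_aeval_rootCoeff_eq_of_isSymmetric {p : MvPolynomial (Fin d) S} (hp : p.IsSymmetric) :
    ∃ g : MvPolynomial (Fin d) S, MvPolynomial.aeval (rootCoeff S d) g = p := by
  obtain ⟨g, hg⟩ := MvPolynomial.esymmAlgHom_surjective (σ := Fin d) S (n := d) (by simp) ⟨p, hp⟩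
  have hg' : MvPolynomial.aeval (fun i : Fin d => MvPolynomial.esymm (Fin d) S (i + 1)) g = p := by
    rw [← MvPolynomial.esymmAlgHom_apply, hg]
  -- The substitution absorbs the signs between the coefficients and the elementary symmetric
  -- polynomials.
  refine ⟨MvPolynomial.aeval (fun i : Fin d => (-1) ^ (i + 1 : ℕ) * MvPolynomial.X i) g, ?_⟩
  rw [← hg', ← AlgHom.comp_apply]
  congr 1
  ext i : 1
  simp [rootCoeff, ← mul_assoc, ← mul_pow]

/-- Passage from identities in universal roots to actual roots: both sides are homomorphisms in `g`
that agree on constants and variables. -/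
theorem eval₂_aeval_rootCoeff (θ : S →+* A) {a α : Fin d → A}
    (h : monicPoly a = ∏ i, (X - C (α i))) (g : MvPolynomial (Fin d) S) :
    MvPolynomial.eval₂ θ α (MvPolynomial.aeval (rootCoeff S d) g) =
      MvPolynomial.eval₂ θ a g := by
  have : (MvPolynomial.eval₂Hom θ α).comp (MvPolynomial.aeval (rootCoeff S d)).toRingHom =
      MvPolynomial.eval₂Hom θ a := by
    apply MvPolynomial.ringHom_ext
    · intro r; simp
    · intro i; simpa using eval₂_rootCoeff θ h i
  exact congrArg (fun f => f g) this

/-- The elementary symmetric functions of a family permuted by the permutations of the variables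
are polynomials in the coefficients. -/
theorem exists_aeval_rootCoeff_eq_familyEsymm {T : Type*} [Fintype T]
    (φ : T → MvPolynomial (Fin d) S)
    (hφ : ∀ e : Equiv.Perm (Fin d), ∃ e' : T ≃ T,
      ∀ τ, MvPolynomial.rename e (φ τ) = φ (e' τ)) (r : ℕ) :
    ∃ g : MvPolynomial (Fin d) S, MvPolynomial.aeval (rootCoeff S d) g = familyEsymm φ r := by
  apply exists_aeval_rootCoeff_eq_of_isSymmetric
  intro e
  obtain ⟨e', he'⟩ := hφ e
  -- Both sides are reindexed by `e'`, so that the renamed family reads `φ (e' (e' τ))`; the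
  -- reindexings are then removed.
  rw [← familyEsymm_comp_equiv φ e', ← AlgHom.coe_toRingHom, map_familyEsymm]
  simp only [AlgHom.coe_toRingHom]
  simp_rw [he']
  rw [familyEsymm_comp_equiv φ e', familyEsymm_comp_equiv (fun τ => φ (e' τ)) e',
    familyEsymm_comp_equiv φ e']

end Roots

/-! ### Coefficient ideals and specializations -/

section Specialize

variable {d : ℕ}

/-- Substitute the last variable for the variable of the coefficient ring. -/
noncomputable def snocVar (d : ℕ) :
    MvPolynomial (Fin d) ℚ[X] →+* MvPolynomial (Fin (d + 1)) ℚ :=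
  MvPolynomial.eval₂Hom (aeval (MvPolynomial.X (Fin.last d))).toRingHom
    fun i => MvPolynomial.X i.castSucc

theorem aeval_snocVar {B : Type*} [CommRing B] [Algebra ℚ B] (a : Fin d → B) (w : B)
    (g : MvPolynomial (Fin d) ℚ[X]) :
    MvPolynomial.aeval (Fin.snoc a w : Fin (d + 1) → B) (snocVar d g) =
      MvPolynomial.eval₂ (aeval w : ℚ[X] →ₐ[ℚ] B).toRingHom a g := by
  have : (MvPolynomial.aeval (Fin.snoc a w : Fin (d + 1) → B)).toRingHom.comp (snocVar d) =
      MvPolynomial.eval₂Hom (aeval w : ℚ[X] →ₐ[ℚ] B).toRingHom a := by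
    apply MvPolynomial.ringHom_ext'
    · apply Polynomial.ringHom_ext'
      · exact Subsingleton.elim _ _
      · simp [snocVar]
    · intro i; simp [snocVar]
  exact congrArg (fun f => f g) this

/-- Exchange the variable of the coefficient ring with the other variables. -/
noncomputable def varSwap (d : ℕ) :
    MvPolynomial (Fin d) ℚ[X] →+* (MvPolynomial (Fin d) ℚ)[X] :=
  MvPolynomial.eval₂Hom (mapRingHom MvPolynomial.C) fun i => C (MvPolynomial.X i)

/-- The ideal generated by the coefficients with respect to the variable of the coefficient
ring. -/
noncomputable def coeffIdeal (g : MvPolynomial (Fin d) ℚ[X]) : Ideal (MvPolynomial (Fin d) ℚ) :=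
  Ideal.span (Set.range (varSwap d g).coeff)

variable {K : Type*} [Field K] [CharZero K]

/-- The inclusion of `ℚ[s]` in `K[s]⟦t⟧`. -/
noncomputable def constPoly (K : Type*) [Field K] [CharZero K] : ℚ[X] →+* PowerSeries K[X] :=
  (PowerSeries.C).comp (mapRingHom (algebraMap ℚ K))

/-- Collecting powers of `s` before or after substituting `a` gives the same element of `K[s]⟦t⟧`.
-/
theorem powerSeriesSwap_map_varSwap (a : Fin d → PowerSeries K)
    (g : MvPolynomial (Fin d) ℚ[X]) :
    powerSeriesSwap K ((varSwap d g).map (MvPolynomial.aeval a).toRingHom) =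
      MvPolynomial.eval₂ (constPoly K) (fun i => PowerSeries.map C (a i)) g := by
  have : ((powerSeriesSwap K).comp (mapRingHom (MvPolynomial.aeval a).toRingHom)).comp
      (varSwap d) = MvPolynomial.eval₂Hom (constPoly K) fun i => PowerSeries.map C (a i) := by
    apply MvPolynomial.ringHom_ext'
    · apply Polynomial.ringHom_ext'
      · exact Subsingleton.elim _ _
      · simp [varSwap, powerSeriesSwap, constPoly]
    · intro i; simp [varSwap, powerSeriesSwap]
  exact congrArg (fun f => f g) this

/-- By Gauss's lemma the order is the least one among the `s`-coefficients, which generate the image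
of the coefficient ideal; the factor `N` comes from `t = (t^{1/N}) ^ N`. -/
theorem order_eval₂_constPoly (N : ℕ) (hN : N ≠ 0) (a : Fin d → PowerSeries K)
    (g : MvPolynomial (Fin d) ℚ[X]) :
    (MvPolynomial.eval₂ (constPoly K)
      (fun i => PowerSeries.map C (PowerSeries.expand N hN (a i))) g).order =
      N * idealOrd ((coeffIdeal g).map (MvPolynomial.aeval a).toRingHom) := by
  rw [← powerSeriesSwap_map_varSwap, order_powerSeriesSwap, coeffIdeal, Ideal.map_span,
    ← Set.range_comp, idealOrd_span_range, ENat.mul_iInf]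
  congr 1
  ext n : 1
  have h : MvPolynomial.aeval (fun i => PowerSeries.expand N hN (a i)) ((varSwap d g).coeff n) =
      PowerSeries.expand N hN (MvPolynomial.aeval a ((varSwap d g).coeff n)) := by
    have := MvPolynomial.comp_aeval_apply a ((PowerSeries.expand N hN).restrictScalars ℚ)
      ((varSwap d g).coeff n)
    exact this.symm
  simp only [coeff_map, AlgHom.toRingHom_eq_coe, RingHom.coe_coe, Function.comp_apply]
  rw [h, PowerSeries.order_expand, nsmul_eq_mul]

end Specialize

/-! ### The maximum over the roots -/

section Maximum

variable {d m : ℕ}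

/-- A generic combination of the polynomials `fⱼ(a₁, …, a_d, xᵢ)`, where `a₁, …, a_d` are the
coefficients of the polynomial with roots `x₁, …, x_d`. -/
noncomputable def genericAtRoot (f : Fin m → MvPolynomial (Fin (d + 1)) ℚ) (i : Fin d) :
    MvPolynomial (Fin d) ℚ[X] :=
  ∑ j : Fin m, MvPolynomial.C (X ^ (j : ℕ)) *
    MvPolynomial.aeval (Fin.snoc (rootCoeff ℚ[X] d) (MvPolynomial.X i) :
      Fin (d + 1) → MvPolynomial (Fin d) ℚ[X]) (f j)

/-- The coefficients are symmetric in the roots, so only the last argument `xᵢ` moves. -/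
theorem rename_genericAtRoot (f : Fin m → MvPolynomial (Fin (d + 1)) ℚ) (e : Equiv.Perm (Fin d))
    (i : Fin d) : MvPolynomial.rename e (genericAtRoot f i) = genericAtRoot f (e i) := by
  simp only [genericAtRoot, map_sum, map_mul, MvPolynomial.rename_C]
  refine Finset.sum_congr rfl fun j _ => ?_
  congr 1
  have h := MvPolynomial.comp_aeval_apply (Fin.snoc (rootCoeff ℚ[X] d) (MvPolynomial.X i) :
      Fin (d + 1) → MvPolynomial (Fin d) ℚ[X])
    ((MvPolynomial.rename (R := ℚ[X]) e).restrictScalars ℚ) (f j)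
  refine h.trans ?_
  congr 2
  funext l
  refine Fin.lastCases ?_ (fun l => ?_) l
  · simp
  · simpa using isSymmetric_rootCoeff l e

variable {K : Type*} [Field K] [CharZero K]

theorem eval₂_genericAtRoot (f : Fin m → MvPolynomial (Fin (d + 1)) ℚ)
    {a α : Fin d → PowerSeries K} (h : monicPoly a = ∏ i, (X - C (α i))) (i : Fin d) :
    MvPolynomial.eval₂ (constPoly K) (fun l => PowerSeries.map C (α l)) (genericAtRoot f i) =
      powerSeriesSwap K (∑ j : Fin m, C (MvPolynomial.aeval
        (Fin.snoc a (α i) : Fin (d + 1) → PowerSeries K) (f j)) * X ^ (j : ℕ)) := by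
  have h' : monicPoly (fun l => PowerSeries.map (C : K →+* K[X]) (a l)) =
      ∏ l, (X - C (PowerSeries.map (C : K →+* K[X]) (α l))) := by
    rw [← map_monicPoly, h]
    simp [Polynomial.map_prod]
  rw [← MvPolynomial.coe_eval₂Hom, genericAtRoot, map_sum, map_sum]
  refine Finset.sum_congr rfl fun j _ => ?_
  rw [map_mul, map_mul, mul_comm]
  congr 1
  · have hom : (MvPolynomial.eval₂Hom (constPoly K) fun l => PowerSeries.map C (α l)).comp
        (MvPolynomial.aeval (Fin.snoc (rootCoeff ℚ[X] d) (MvPolynomial.X i) :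
          Fin (d + 1) → MvPolynomial (Fin d) ℚ[X])).toRingHom =
        ((powerSeriesSwap K).comp C).comp (MvPolynomial.aeval (R := ℚ)
          (Fin.snoc a (α i) : Fin (d + 1) → PowerSeries K)).toRingHom := by
      apply MvPolynomial.ringHom_ext'
      · exact Subsingleton.elim _ _
      · intro l
        refine Fin.lastCases ?_ (fun l => ?_) l
        · simp [powerSeriesSwap]
        · simpa [powerSeriesSwap] using eval₂_rootCoeff (constPoly K) h' l
    exact congrArg (fun g => g (f j)) hom
  · simp [constPoly, powerSeriesSwap]

/-- The generators occur as coefficients of distinct powers of `s`, so the generic combination has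
the least of their orders. -/
theorem order_eval₂_genericAtRoot (f : Fin m → MvPolynomial (Fin (d + 1)) ℚ)
    {a α : Fin d → PowerSeries K} (h : monicPoly a = ∏ i, (X - C (α i))) (i : Fin d) :
    (MvPolynomial.eval₂ (constPoly K) (fun l => PowerSeries.map C (α l))
      (genericAtRoot f i)).order = idealOrd ((Ideal.span (Set.range f)).map
        (MvPolynomial.aeval (Fin.snoc a (α i) : Fin (d + 1) → PowerSeries K)).toRingHom) := by
  rw [eval₂_genericAtRoot f h, order_powerSeriesSwap, Ideal.map_span, ← Set.range_comp,
    idealOrd_span_range]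
  have hc : ∀ (b : Fin m → PowerSeries K) (n : ℕ),
      (∑ j : Fin m, C (b j) * X ^ (j : ℕ)).coeff n = if hn : n < m then b ⟨n, hn⟩ else 0 := by
    intro b n
    simp only [finsetSum_coeff, coeff_C_mul_X_pow]
    split_ifs with hn
    · rw [Finset.sum_eq_single ⟨n, hn⟩]
      · simp
      · intro j _ hj
        exact if_neg fun h => hj (Fin.ext h.symm)
      · simp
    · exact Finset.sum_eq_zero fun j _ => if_neg (by omega)
  apply le_antisymm
  · refine le_iInf fun j => (iInf_le _ (j : ℕ)).trans ?_
    rw [hc, dif_pos j.2]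
    rfl
  · refine le_iInf fun n => ?_
    rw [hc]
    split_ifs with hn
    · exact iInf_le _ (⟨n, hn⟩ : Fin m)
    · simp

/-- Removing a maximal term from a finite sum. -/
theorem exists_max_add_iInf_sum_erase [NeZero d] (β : Fin d → ℕ∞) :
    ∃ i₀, (∀ i, β i ≤ β i₀) ∧
      (⨅ i, ∑ j ∈ Finset.univ.erase i, β j) = ∑ j ∈ Finset.univ.erase i₀, β j := by
  obtain ⟨i₀, -, hi₀⟩ := Finset.exists_max_image Finset.univ β ⟨0, Finset.mem_univ _⟩
  refine ⟨i₀, fun i => hi₀ i (Finset.mem_univ i), le_antisymm (iInf_le _ i₀) ?_⟩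
  refine le_iInf fun i => ?_
  rcases eq_or_ne i i₀ with rfl | hne
  · exact le_rfl
  have h₁ : i ∈ Finset.univ.erase i₀ := by simp [hne]
  have h₂ : i₀ ∈ Finset.univ.erase i := by simp [hne.symm]
  -- The two sums differ only in that one contains `β i` and the other `β i₀`.
  rw [← Finset.add_sum_erase _ _ h₁, ← Finset.add_sum_erase _ _ h₂, Finset.erase_right_comm]
  gcongr
  exact hi₀ i (Finset.mem_univ i)

/-- The minimum is at most the average, and each `β j` occurs in exactly `d - 1` of the `d` sums. -/
theorem mul_iInf_sum_erase_le [NeZero d] (β : Fin d → ℕ∞) :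
    d * (⨅ i, ∑ j ∈ Finset.univ.erase i, β j) ≤ (d - 1 : ℕ) * ∑ j, β j := by
  calc (d : ℕ∞) * (⨅ i, ∑ j ∈ Finset.univ.erase i, β j)
      = ∑ _i : Fin d, (⨅ i, ∑ j ∈ Finset.univ.erase i, β j) := by simp
    _ ≤ ∑ i : Fin d, ∑ j ∈ Finset.univ.erase i, β j :=
        Finset.sum_le_sum fun i _ => iInf_le _ i
    _ = ∑ j : Fin d, ∑ i ∈ Finset.univ.erase j, β j := by
        refine Finset.sum_comm' fun i j => ?_
        simp [eq_comm]
    _ = (d - 1 : ℕ) * ∑ j, β j := by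
        simp [Finset.mul_sum]

/-- For an ideal `J` of `ℚ[z₁, …, z_{d+1}]` there are ideals of `ℚ[z₁, …, z_d]` measuring the sum
of the orders of `J` at the roots, and `d!` times the smallest sum of all these orders but one. -/
theorem exists_ideals_sum_order (d : ℕ) (hd : 1 ≤ d)
    (J : Ideal (MvPolynomial (Fin (d + 1)) ℚ)) :
    ∃ P M : Ideal (MvPolynomial (Fin d) ℚ), P ^ ((d - 1) * (d.factorial / d)) ≤ M ∧
      ∀ (K : Type*) [Field K] [CharZero K] (N : ℕ) (hN : N ≠ 0) (a α : Fin d → PowerSeries K),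
        AreRoots N hN a α → ∀ β : Fin d → ℕ∞,
        (∀ i, β i = idealOrd (J.map (MvPolynomial.aeval (Fin.snoc
          (fun j => PowerSeries.expand N hN (a j)) (α i) :
            Fin (d + 1) → PowerSeries K)).toRingHom)) →
        N * idealOrd (P.map (MvPolynomial.aeval a).toRingHom) = ∑ i, β i ∧
        N * idealOrd (M.map (MvPolynomial.aeval a).toRingHom) =
          d.factorial * ⨅ i, ∑ j ∈ Finset.univ.erase i, β j := by
  have : NeZero d := ⟨by omega⟩
  obtain ⟨m, f, hf⟩ := Submodule.fg_iff_exists_fin_generating_family.mp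
    (IsNoetherian.noetherian J)
  have hf' : Ideal.span (Set.range f) = J := hf
  have hsymm : ∀ e : Equiv.Perm (Fin d), ∃ e' : Fin d ≃ Fin d, ∀ i,
      MvPolynomial.rename e (∏ j ∈ Finset.univ.erase i, genericAtRoot f j) =
        ∏ j ∈ Finset.univ.erase (e' i), genericAtRoot f j := by
    refine fun e => ⟨e, fun i => ?_⟩
    rw [map_prod]
    simp only [rename_genericAtRoot]
    exact Finset.prod_equiv e (by simp) (by simp)
  choose g hg using exists_aeval_rootCoeff_eq_familyEsymm
    (fun i : Fin d => ∏ j ∈ Finset.univ.erase i, genericAtRoot f j) hsymm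
  obtain ⟨p, hp⟩ := exists_aeval_rootCoeff_eq_of_isSymmetric (p := ∏ i, genericAtRoot f i) (by
    intro e
    rw [map_prod]
    simp only [rename_genericAtRoot]
    exact Equiv.prod_comp e _)
  -- The supremum alone has the required order; the power of `coeffIdeal p` is added only to make
  -- the inclusion hold by construction.
  refine ⟨coeffIdeal p, (⨆ r : Fin d, coeffIdeal (g (r + 1)) ^ (d.factorial / (r + 1 : ℕ))) ⊔
    coeffIdeal p ^ ((d - 1) * (d.factorial / d)), le_sup_right, ?_⟩
  intro K _ _ N hN a α hα β hβ
  have h' : monicPoly (fun l => PowerSeries.map (C : K →+* K[X]) (PowerSeries.expand N hN (a l))) =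
      ∏ l, (X - C (PowerSeries.map (C : K →+* K[X]) (α l))) := by
    have h := congrArg (Polynomial.map (PowerSeries.map (C : K →+* K[X]))) hα
    rw [map_monicPoly] at h
    rw [h]
    simp [Polynomial.map_prod]
  set ev := MvPolynomial.eval₂Hom (constPoly K) fun l => PowerSeries.map (C : K →+* K[X]) (α l)
  have hF : ∀ i, (ev (genericAtRoot f i)).order = β i := by
    intro i
    rw [hβ, ← hf']
    exact order_eval₂_genericAtRoot f hα i
  have hP : N * idealOrd ((coeffIdeal p).map (MvPolynomial.aeval a).toRingHom) = ∑ i, β i := by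
    rw [← order_eval₂_constPoly N hN, ← eval₂_aeval_rootCoeff _ h', hp]
    change (ev _).order = _
    rw [map_prod, PowerSeries.order_prod]
    exact Finset.sum_congr rfl fun i _ => hF i
  have hE : ∀ r, N * idealOrd ((coeffIdeal (g r)).map (MvPolynomial.aeval a).toRingHom) =
      (familyEsymm (fun i => ∏ j ∈ Finset.univ.erase i, ev (genericAtRoot f j)) r).order := by
    intro r
    rw [← order_eval₂_constPoly N hN, ← eval₂_aeval_rootCoeff _ h', hg]
    change (ev _).order = _
    rw [map_familyEsymm]
    simp only [map_prod]
  refine ⟨hP, ?_⟩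
  have hmin := iInf_order_familyEsymm
    (fun i : Fin d => ∏ j ∈ Finset.univ.erase i, ev (genericAtRoot f j)) (Fintype.card_fin d)
  simp only [PowerSeries.order_prod, hF, ← hE] at hmin
  rw [Ideal.map_sup, Ideal.map_iSup, idealOrd_sup, idealOrd_iSup, ← hmin]
  simp only [Ideal.map_pow, idealOrd_pow]
  rw [show ∀ x y : ℕ∞, (N : ℕ∞) * min x y = min (N * x) (N * y) from fun x y =>
    Monotone.map_min (f := fun x : ℕ∞ => N * x) fun _ _ h => by dsimp only; gcongr]
  have : Nonempty (Fin d) := ⟨0⟩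
  rw [ENat.mul_iInf]
  simp only [mul_left_comm (N : ℕ∞)]
  -- The added power does not lower the order, by the averaging inequality multiplied by `d! / d`.
  rw [min_eq_left]
  rw [hmin, hP, ← cast_factorial_div_mul hd le_rfl, mul_assoc, mul_comm (d - 1), Nat.cast_mul,
    mul_assoc]
  exact mul_le_mul' le_rfl (mul_iInf_sum_erase_le β)

/-- An inclusion of powers is preserved by taking further powers, so no genuine integral closure is
involved. -/
theorem QSymbol.LE.of_pow_le {R : Type*} [CommRing R] {s t : QSymbol R} {n : ℕ}
    (h : s.ideal ^ n ≤ t.ideal) (hn : n * t.exp = s.exp) : s.LE t := by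
  intro m n₁ n₂ _ h₁ h₂
  have : n₁ = n * n₂ := by
    have : (n₁ : ℚ≥0) = n * n₂ := by rw [← h₁, ← h₂, ← hn]; ring
    exact_mod_cast this
  rw [this, pow_mul]
  exact (Ideal.pow_right_mono h n₂).trans (le_idealClosure _)

/-- The hypothesis rules out `x` finite with `y` infinite, where the convention `∞ - ∞ = ∞` would
give the wrong value. -/
theorem ordSub_add_left {x y : ℝ≥0∞} (h : x + y = ⊤ → x = ⊤) : (x : EReal) = ordSub (x + y) y := by
  unfold ordSub
  split_ifs with ht
  · rw [h ht]; rfl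
  · have hx : x ≠ ⊤ := fun hx => ht (by simp [hx])
    have hy : y ≠ ⊤ := fun hy => ht (by simp [hy])
    lift x to ℝ≥0 using hx
    lift y to ℝ≥0 using hy
    rw [EReal.coe_ennreal_add, EReal.coe_nnreal_eq_coe_real y,
      EReal.add_sub_cancel_right]

/-- The maximum over the roots of the order of a `ℚ`-ideal is the difference of the orders of two
`ℚ`-ideals in the coefficients. -/
theorem exists_qideals_max_order (d : ℕ) (hd : 1 ≤ d)
    (𝔟 : QIdeal (MvPolynomial (Fin (d + 1)) ℚ)) :
    ∃ 𝔟plus 𝔟minus : QIdeal (MvPolynomial (Fin d) ℚ),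
      ∀ (K : Type*) [Field K] [CharZero K],
        (∀ hd : 2 ≤ d, 𝔟plus.baseChange K ≤
          (𝔟minus.baseChange K).pow ((d : ℚ≥0) / ((d - 1 : ℕ) : ℚ≥0)) (exponent_pos hd)) ∧
        ∀ (N : ℕ) (hN : N ≠ 0) (a α : Fin d → PowerSeries K), AreRoots N hN a α →
          (((⨆ i : Fin d, (𝔟.evalAt
              (Fin.snoc (fun j => PowerSeries.expand N hN (a j)) (α i))).ord N : ℝ≥0∞)) : EReal) =
            ordSub ((𝔟plus.evalAt a).ord 1) ((𝔟minus.evalAt a).ord 1) := by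
  have : NeZero d := ⟨by omega⟩
  induction 𝔟 using Quotient.inductionOn with
  | h s =>
  obtain ⟨J, q, hq⟩ := s
  obtain ⟨P, M, hPM, hord⟩ := exists_ideals_sum_order d hd J
  have hfac : (0 : ℚ≥0) < d.factorial := by exact_mod_cast d.factorial_pos
  let sP : QSymbol (MvPolynomial (Fin d) ℚ) := ⟨P, q, hq⟩
  -- The exponent `q / d!` undoes the factor `d!` in the order of `M`.
  let sM : QSymbol (MvPolynomial (Fin d) ℚ) := ⟨M, q / d.factorial, div_pos hq hfac⟩
  refine ⟨Quotient.mk _ sP, Quotient.mk _ sM, fun K _ _ => ⟨fun hd2 => ?_, ?_⟩⟩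
  · have h : sP.LE (sM.pow ((d : ℚ≥0) / ((d - 1 : ℕ) : ℚ≥0)) (exponent_pos hd2)) := by
      refine QSymbol.LE.of_pow_le hPM ?_
      have hdvd : d.factorial / d * d = d.factorial :=
        Nat.div_mul_cancel (Nat.dvd_factorial hd le_rfl)
      have h₁ : ((d - 1 : ℕ) : ℚ≥0) ≠ 0 := by exact_mod_cast (by omega : d - 1 ≠ 0)
      change (((d - 1) * (d.factorial / d) : ℕ) : ℚ≥0) *
        (q / d.factorial * ((d : ℚ≥0) / ((d - 1 : ℕ) : ℚ≥0))) = q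
      rw [Nat.cast_mul]
      have hdvd' : ((d.factorial / d : ℕ) : ℚ≥0) * d = d.factorial := by exact_mod_cast hdvd
      calc _ = q / d.factorial * (((d.factorial / d : ℕ) : ℚ≥0) * d) := by field_simp
        _ = q := by rw [hdvd']; field_simp
    exact h.map (MvPolynomial.map (algebraMap ℚ K))
  · intro N hN a α hα
    obtain ⟨hP, hM⟩ := hord K N hN a α hα _ fun i => rfl
    set β : Fin d → ℕ∞ := fun i => idealOrd (J.map (MvPolynomial.aeval (Fin.snoc
      (fun j => PowerSeries.expand N hN (a j)) (α i) : Fin (d + 1) → PowerSeries K)).toRingHom)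
    obtain ⟨i₀, hmax, hinf⟩ := exists_max_add_iInf_sum_erase β
    rw [hinf] at hM
    rw [← Finset.add_sum_erase _ _ (Finset.mem_univ i₀)] at hP
    set y := ∑ j ∈ Finset.univ.erase i₀, β j
    -- An infinite remaining sum has an infinite term, which forces the maximum to be infinite; this
    -- is what the convention `∞ - ∞ = ∞` needs.
    have hytop : y = ⊤ → β i₀ = ⊤ := by
      intro h
      obtain ⟨j, -, hj⟩ := WithTop.sum_eq_top.mp h
      exact top_le_iff.mp (hj ▸ hmax j)
    set Q : ℝ≥0∞ := ((q : ℝ≥0) : ℝ≥0∞) with hQ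
    have hQ0 : Q ≠ 0 := by simp [hQ, hq.ne']
    have hQtop : Q ≠ ⊤ := ENNReal.coe_ne_top
    have hN0 : (N : ℝ≥0∞) ≠ 0 := by exact_mod_cast hN
    have hNtop : (N : ℝ≥0∞) ≠ ⊤ := ENNReal.natCast_ne_top N
    have hsup : (⨆ i : Fin d, (QIdeal.evalAt (Quotient.mk _ ⟨J, q, hq⟩)
        (Fin.snoc (fun j => PowerSeries.expand N hN (a j)) (α i))).ord N) =
        Q * ((β i₀ : ℝ≥0∞) / N) := by
      change (⨆ i : Fin d, Q * ((β i : ℝ≥0∞) / N)) = _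
      refine le_antisymm (iSup_le fun i => ?_) (le_iSup (fun i => Q * ((β i : ℝ≥0∞) / N)) i₀)
      gcongr
      exact hmax i
    have hplus : (QIdeal.evalAt (Quotient.mk _ sP) a).ord 1 =
        Q * ((β i₀ : ℝ≥0∞) / N) + Q * ((y : ℝ≥0∞) / N) := by
      change Q * ((idealOrd (P.map (MvPolynomial.aeval a).toRingHom) : ℝ≥0∞) / (1 : ℕ)) = _
      have h := congrArg (fun x : ℕ∞ => (x : ℝ≥0∞)) hP
      simp only [ENat.toENNReal_mul, ENat.toENNReal_add, ENat.toENNReal_coe] at h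
      rw [← mul_add, ← ENNReal.add_div, ← h, Nat.cast_one, div_one, mul_comm (N : ℝ≥0∞),
        ENNReal.mul_div_cancel_right hN0 hNtop]
    have hminus : (QIdeal.evalAt (Quotient.mk _ sM) a).ord 1 = Q * ((y : ℝ≥0∞) / N) := by
      change (((q / d.factorial : ℚ≥0) : ℝ≥0) : ℝ≥0∞) *
        ((idealOrd (M.map (MvPolynomial.aeval a).toRingHom) : ℝ≥0∞) / (1 : ℕ)) = _
      have h := congrArg (fun x : ℕ∞ => (x : ℝ≥0∞)) hM
      simp only [ENat.toENNReal_mul, ENat.toENNReal_coe] at h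
      have hf0 : (d.factorial : ℝ≥0∞) ≠ 0 := by exact_mod_cast d.factorial_ne_zero
      have hftop : (d.factorial : ℝ≥0∞) ≠ ⊤ := ENNReal.natCast_ne_top _
      have hq' : (((q / d.factorial : ℚ≥0) : ℝ≥0) : ℝ≥0∞) = Q / d.factorial := by
        rw [NNRat.cast_div, NNRat.cast_natCast,
          ENNReal.coe_div (by exact_mod_cast d.factorial_ne_zero)]
        simp [hQ]
      set z : ℝ≥0∞ := (idealOrd (M.map (MvPolynomial.aeval a).toRingHom) : ℝ≥0∞)
      have hz : z = d.factorial * y / N := by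
        rw [← h, mul_comm (N : ℝ≥0∞), ENNReal.mul_div_cancel_right hN0 hNtop]
      rw [hq', hz, Nat.cast_one, div_one, mul_div_assoc, ← mul_assoc,
        ENNReal.div_mul_cancel hf0 hftop]
    rw [hsup, hplus, hminus]
    apply ordSub_add_left
    intro h
    rcases ENNReal.add_eq_top.mp h with h | h
    · exact h
    · have : y = ⊤ := by
        by_contra hne
        refine ENNReal.mul_ne_top hQtop (ENNReal.div_ne_top ?_ hN0) h
        simpa using hne
      rw [hytop this]
      simp [ENNReal.top_div, hNtop, hQ0]

end Maximum

/-! ### Minima over products of differences of roots -/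

section Differences

/-- There is an ideal whose order at `(a, w)` is a fixed multiple of the smallest order of a product
of `k` differences `αⱼ - w`. -/
theorem exists_ideal_iInf_order_prod_sub {d k : ℕ} (hk : k ≤ d) :
    ∃ (B : Ideal (MvPolynomial (Fin (d + 1)) ℚ)) (n : ℕ), n ≠ 0 ∧
      ∀ (K : Type*) [Field K] [CharZero K] (N : ℕ) (hN : N ≠ 0) (a α : Fin d → PowerSeries K),
        AreRoots N hN a α → ∀ w : PowerSeries K,
        idealOrd (B.map (MvPolynomial.aeval (Fin.snoc
          (fun j => PowerSeries.expand N hN (a j)) w : Fin (d + 1) → PowerSeries K)).toRingHom) =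
        n * ⨅ j : Fin k ↪ Fin d, (∏ l, (α (j l) - w)).order := by
  -- The coefficient variable stands for `w`. Permuting the roots permutes the embeddings, so the
  -- elementary symmetric functions of this family are polynomials in `a` and `w`.
  let φ : (Fin k ↪ Fin d) → MvPolynomial (Fin d) ℚ[X] := fun j =>
    ∏ l, (MvPolynomial.X (j l) - MvPolynomial.C X)
  have : Nonempty (Fin k ↪ Fin d) := ⟨Fin.castLEEmb hk⟩
  choose g hg using exists_aeval_rootCoeff_eq_familyEsymm φ fun e =>
    ⟨Equiv.embeddingCongr (Equiv.refl _) e, fun j => by simp [φ, map_prod]⟩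
  set n := Fintype.card (Fin k ↪ Fin d) with hn
  refine ⟨Ideal.span (Set.range fun r : Fin n =>
    snocVar d (g (r + 1)) ^ (n.factorial / (r + 1 : ℕ))), n.factorial, n.factorial_ne_zero, ?_⟩
  intro K _ _ N hN a α hα w
  have hφ : ∀ j, MvPolynomial.eval₂Hom (aeval w : ℚ[X] →ₐ[ℚ] PowerSeries K).toRingHom α (φ j) =
      ∏ l, (α (j l) - w) := by
    intro j
    simp [φ, map_prod]
  rw [Ideal.map_span, ← Set.range_comp, idealOrd_span_range, ← iInf_order_familyEsymm _ hn.symm]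
  congr 1
  funext r
  simp only [AlgHom.toRingHom_eq_coe, RingHom.coe_coe, Function.comp_apply, map_pow]
  rw [PowerSeries.order_pow, nsmul_eq_mul, aeval_snocVar, ← eval₂_aeval_rootCoeff _ hα, hg,
    ← MvPolynomial.coe_eval₂Hom, map_familyEsymm]
  simp only [hφ]

/-- Since `k ≤ d`, the infimum is over a nonempty family and is attained, so it commutes with the
cast and the division by `N`. -/
theorem minOrdProd_eq {K : Type*} [Field K] (N : ℕ) {d k : ℕ} (hk : k ≤ d)
    (α : Fin d → PowerSeries K) (w : PowerSeries K) :
    minOrdProd N k α w =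
      ((⨅ j : Fin k ↪ Fin d, (∏ l, (α (j l) - w)).order : ℕ∞) : ℝ≥0∞) / N := by
  have : Nonempty (Fin k ↪ Fin d) := ⟨Fin.castLEEmb hk⟩
  obtain ⟨j₀, hj₀⟩ := ENat.exists_eq_iInf fun j : Fin k ↪ Fin d => (∏ l, (α (j l) - w)).order
  refine le_antisymm ?_ (le_iInf fun j => ?_)
  · rw [← hj₀]
    exact iInf_le _ j₀
  · unfold ordT
    gcongr
    exact iInf_le _ j

/-- There is a `ℚ`-ideal whose order at `(a, w)` is a given combination of minima of orders of
products of differences `αⱼ - w`. -/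
theorem exists_qideal_ord_eq_minOrdProd {d k k' : ℕ} (hk : k ≤ d) (hk' : k' ≤ d) (c c' : ℚ≥0) :
    ∃ 𝔟 : QIdeal (MvPolynomial (Fin (d + 1)) ℚ),
      ∀ (K : Type*) [Field K] [CharZero K] (N : ℕ) (hN : N ≠ 0) (a α : Fin d → PowerSeries K),
        AreRoots N hN a α → ∀ w : PowerSeries K,
        (𝔟.evalAt (Fin.snoc (fun j => PowerSeries.expand N hN (a j)) w)).ord N =
          ((c : ℝ≥0) : ℝ≥0∞) * minOrdProd N k α w +
            ((c' : ℝ≥0) : ℝ≥0∞) * minOrdProd N k' α w := by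
  obtain ⟨B, n, hn, hB⟩ := exists_ideal_iInf_order_prod_sub hk
  obtain ⟨B', n', hn', hB'⟩ := exists_ideal_iInf_order_prod_sub hk'
  have hn0 : (n : ℚ≥0) ≠ 0 := by exact_mod_cast hn
  have hn0' : (n' : ℚ≥0) ≠ 0 := by exact_mod_cast hn'
  have hd0 : (c.den : ℚ≥0) ≠ 0 := by exact_mod_cast c.den_ne_zero
  have hd0' : (c'.den : ℚ≥0) ≠ 0 := by exact_mod_cast c'.den_ne_zero
  -- A common denominator: the exponents of `B` and `B'` below are chosen so that `q` times exponent
  -- times `n` or `n'` is `c` or `c'`. A zero coefficient gives exponent zero, hence the unit ideal,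
  -- in accordance with `0 · ∞ = 0`.
  let q : ℚ≥0 := ((c.den : ℚ≥0) * c'.den * n * n')⁻¹
  have hq : 0 < q := by positivity
  have hc : q * ((c.num * c'.den * n' : ℕ) * n) = c := by
    conv_rhs => rw [← NNRat.num_div_den c]
    simp only [q]
    push_cast
    field_simp
  have hc' : q * ((c'.num * c.den * n : ℕ) * n') = c' := by
    conv_rhs => rw [← NNRat.num_div_den c']
    simp only [q]
    push_cast
    field_simp
  have cast : ∀ {x y : ℚ≥0} {i j : ℕ}, x * (i * j) = y →
      ((x : ℝ≥0) : ℝ≥0∞) * (i * j) = ((y : ℝ≥0) : ℝ≥0∞) := by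
    rintro x _ i j rfl
    push_cast
    rfl
  refine ⟨Quotient.mk _
    ⟨B ^ (c.num * c'.den * n') * B' ^ (c'.num * c.den * n), q, hq⟩, ?_⟩
  intro K _ _ N hN a α hα w
  change ((q : ℝ≥0) : ℝ≥0∞) * ((idealOrd (Ideal.map _ (_ * _)) : ℝ≥0∞) / N) = _
  rw [Ideal.map_mul, Ideal.map_pow, Ideal.map_pow, idealOrd_mul, idealOrd_pow, idealOrd_pow,
    hB K N hN a α hα w, hB' K N hN a α hα w, minOrdProd_eq N hk, minOrdProd_eq N hk', ← cast hc,
    ← cast hc']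
  simp only [ENat.toENNReal_add, ENat.toENNReal_mul, ENat.toENNReal_coe, div_eq_mul_inv]
  ring

end Differences

theorem corollary4p10 :
    -- existence of `𝔭plus`, `𝔭minus` for given `d`, `k`, `c₁`, `c₂`
    (∀ (d k : ℕ), 1 ≤ k → k ≤ d → ∀ c₁ c₂ : ℚ≥0,
      ∃ 𝔭plus 𝔭minus : QIdeal (MvPolynomial (Fin d) ℚ),
        ∀ (K : Type*) [Field K] [IsAlgClosed K] [CharZero K],
          (∀ hd : 2 ≤ d, 𝔭plus.baseChange K ≤
            (𝔭minus.baseChange K).pow ((d : ℚ≥0) / ((d - 1 : ℕ) : ℚ≥0)) (exponent_pos hd)) ∧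
          ∀ (N : ℕ) (hN : N ≠ 0) (a α : Fin d → PowerSeries K), AreRoots N hN a α →
            (((⨆ i : Fin d, (((c₁ : ℝ≥0) : ℝ≥0∞) * minOrdProd N (k - 1) α (α i) +
                ((c₂ : ℝ≥0) : ℝ≥0∞) * minOrdProd N k α (α i)) : ℝ≥0∞)) : EReal) =
              ordSub ((𝔭plus.evalAt a).ord 1) ((𝔭minus.evalAt a).ord 1)) ∧
    -- the general case: the maximum over the roots of `ord 𝔟(a, αᵢ)`
    (∀ (d : ℕ), 1 ≤ d → ∀ 𝔟 : QIdeal (MvPolynomial (Fin (d + 1)) ℚ),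
      ∃ 𝔟plus 𝔟minus : QIdeal (MvPolynomial (Fin d) ℚ),
        ∀ (K : Type*) [Field K] [IsAlgClosed K] [CharZero K],
          (∀ hd : 2 ≤ d, 𝔟plus.baseChange K ≤
            (𝔟minus.baseChange K).pow ((d : ℚ≥0) / ((d - 1 : ℕ) : ℚ≥0)) (exponent_pos hd)) ∧
          ∀ (N : ℕ) (hN : N ≠ 0) (a α : Fin d → PowerSeries K), AreRoots N hN a α →
            (((⨆ i : Fin d, (𝔟.evalAt
                (Fin.snoc (fun j => PowerSeries.expand N hN (a j)) (α i))).ord N : ℝ≥0∞)) : EReal) =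
              ordSub ((𝔟plus.evalAt a).ord 1) ((𝔟minus.evalAt a).ord 1)) := by
  constructor
  · intro d k hk hkd c₁ c₂
    -- For `k = 1` the first minimum is over the empty product, of order zero.
    obtain ⟨𝔟, h𝔟⟩ := exists_qideal_ord_eq_minOrdProd (k := k - 1) (k' := k)
      ((Nat.sub_le k 1).trans hkd) hkd c₁ c₂
    obtain ⟨𝔭plus, 𝔭minus, h⟩ := exists_qideals_max_order d (hk.trans hkd) 𝔟
    refine ⟨𝔭plus, 𝔭minus, fun K _ _ _ => ⟨(h K).1, fun N hN a α hα => ?_⟩⟩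
    rw [← (h K).2 N hN a α hα]
    exact congrArg _ (iSup_congr fun i => (h𝔟 K N hN a α hα (α i)).symm)
  · intro d hd 𝔟
    obtain ⟨𝔟plus, 𝔟minus, h⟩ := exists_qideals_max_order d hd 𝔟
    exact ⟨𝔟plus, 𝔟minus, fun K _ _ _ => h K⟩
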